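/- **Theorem 3.9.** Let $m\in\mathbb{N}$, $x_0\in\mathbb{R}$, and let $Q=Q^*$ be an $m\times m$ complex matrix-valued function on $[x_0,\infty)$ (self-adjoint almost everywhere) with $Q\in L^1([x_0,c])^{m\times m}$ for all $c>x_0$. For $z\in\mathbb{C}_+$ and $x\ge x_0$, let $\theta(z,\cdot,x),\phi(z,\cdot,x)$ be the $m\times m$ matrix solutions on $[x,\infty)$ of $-\psi''+Q\psi=z\psi$ (with $\psi'$ locally absolutely continuous and the equation holding a.e.) normalized by $\theta(z,x,x)=\phi'(z,x,x)=I_m$, $\theta'(z,x,x)=\phi(z,x,x)=0$. For $c>x$ let $D(z,c,x)$ be the set of all matrices $$M(z,c,x,\beta)=-\big(\beta_1\phi(z,c,x)+\beta_2\phi'(z,c,x)\big)^{-1}\big(\beta_1\theta(z,c,x)+\beta_2\theta'(z,c,x)\big),$$ where $\beta=[\beta_1\ \beta_2]$ with $\beta_1,\beta_2\in\mathbb{C}^{m\times m}$ ranges over the data such that $\ker(\beta_1^*)\cap\ker(\beta_2^*)=\{0\}$, either $\operatorname{Im}(\beta_2\beta_1^*)>0$ or $\operatorname{Im}(\beta_2\beta_1^*)=0$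 (where $\operatorname{Im}(A)=(A-A^*)/(2i)$), and $\beta_1\phi(z,c,x)+\beta_2\phi'(z,c,x)$ is nonsingular. Let $$D_+(z,x)=\bigcap_{c>x}\overline{D(z,c,x)}$$ be the limit disk, that is, the limit as $c\to\infty$ of the nested sets $\overline{D(z,c,x)}$. For each $z\in\mathbb{C}_+$ and $x\ge x_0$ let $M_+(z,x)$ be a point of $D_+(z,x)$. Let $0<\varepsilon<\pi$ and let $C_\varepsilon=\{z\in\mathbb{C}\setminus\{0\} : |\arg z-\pi/2|<\varepsilon/2\}\subset\mathbb{C}_+$ be the open sector with vertex at zero, symmetry axis along the positive imaginary axis, and opening angle $\varepsilon$. Then, with $\operatorname{Im}(z^{1/2})>0$, $$M_+(z,x)=i z^{1/2}I_m+o(|z|^{1/2})\quad\text{as } |z|\to\infty,\ z\in C_\varepsilon,$$ uniformly with respect to $\arg z$ in $C_\varepsilon$ and uniformly in $x$ as long as $x$ varies in compact subsets of $[x_0,\infty)$. That is, for every compact $K\subset[x_0,\infty)$ and every $\eta>0$ there is $R>0$ such that $\|M_+(z,x)-iz^{1/2}I_m\|\le\eta|z|^{1/2}$ for all $z\in C_\varepsilon$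 with $|z|\ge R$ and all $x\in K$. -/

import Mathlib

/-- `ψ : [a, ∞) → ℂ^{m×m}`, with derivative `ψ'`, is a solution on `[a, ∞)` of the matrix
Schrödinger equation `-ψ'' + Q ψ = z ψ`: `ψ` is differentiable on `[a, ∞)` (one-sidedly at `a`)
with derivative `ψ'`, the entries of `ψ'` are absolutely continuous on every `[a, c]`, and the
equation, in the form `(ψ')' = (Q - z) ψ`, holds almost everywhere on `[a, ∞)`. -/
structure IsSchrodingerSolution {m : ℕ} (Q : ℝ → Matrix (Fin m) (Fin m) ℂ) (z : ℂ) (a : ℝ)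
    (ψ ψ' : ℝ → Matrix (Fin m) (Fin m) ℂ) : Prop where
  hasDeriv : ∀ t ∈ Set.Ici a, HasDerivWithinAt ψ (ψ' t) (Set.Ici a) t
  absCont : ∀ c, a < c → ∀ i j, AbsolutelyContinuousOnInterval (fun t => ψ' t i j) a c
  equation : ∀ᵐ t ∂(MeasureTheory.volume.restrict (Set.Ici a)),
    HasDerivAt ψ' (Q t * ψ t - z • ψ t) t

/-- `θ, φ` (with derivatives `θ', φ'`) is the fundamental system of solutions of
`-ψ'' + Q ψ = z ψ` on `[a, ∞)` normalized at `a` by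
`θ(a) = φ'(a) = I` and `θ'(a) = φ(a) = 0`. -/
structure IsNormalizedFundamentalSystem {m : ℕ} (Q : ℝ → Matrix (Fin m) (Fin m) ℂ) (z : ℂ)
    (a : ℝ) (θ θ' φ φ' : ℝ → Matrix (Fin m) (Fin m) ℂ) : Prop where
  theta_sol : IsSchrodingerSolution Q z a θ θ'
  phi_sol : IsSchrodingerSolution Q z a φ φ'
  theta_init : θ a = 1
  theta'_init : θ' a = 0
  phi_init : φ a = 0
  phi'_init : φ' a = 1

/-- The imaginary part `(A - A^*) / (2i)` of a complex matrix. -/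
noncomputable def matrixIm {m : ℕ} (A : Matrix (Fin m) (Fin m) ℂ) : Matrix (Fin m) (Fin m) ℂ :=
  (1 / (2 * Complex.I)) • (A - A.conjTranspose)

open scoped ComplexOrder in
/-- Admissible boundary data `β = [β₁ β₂]` at the right end point, for spectral parameters in
the open upper half-plane: `ker β₁^* ∩ ker β₂^* = {0}` (that is, `rank β = m`), and
`Im (β₂ β₁^*)` is either positive definite or zero. -/
structure IsBoundaryData {m : ℕ} (β₁ β₂ : Matrix (Fin m) (Fin m) ℂ) : Prop where
  ker_inter : ∀ v : Fin m → ℂ,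
    β₁.conjTranspose.mulVec v = 0 → β₂.conjTranspose.mulVec v = 0 → v = 0
  im_nonneg : (matrixIm (β₂ * β₁.conjTranspose)).PosDef ∨ matrixIm (β₂ * β₁.conjTranspose) = 0

/-- The set `D(z, c, a)`, for `Im z > 0` and `c > a`, of all Weyl–Titchmarsh matrices
`M(z, c, a, β) = -(β₁ φ(c) + β₂ φ'(c))⁻¹ (β₁ θ(c) + β₂ θ'(c))` of the regular boundary value
problems on `[a, c]` with admissible `β` for which `β₁ φ(c) + β₂ φ'(c)` is nonsingular. -/
def weylSet {m : ℕ} (Q : ℝ → Matrix (Fin m) (Fin m) ℂ) (z : ℂ) (c a : ℝ) :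
    Set (Matrix (Fin m) (Fin m) ℂ) :=
  {M | ∃ θ θ' φ φ' : ℝ → Matrix (Fin m) (Fin m) ℂ,
    IsNormalizedFundamentalSystem Q z a θ θ' φ φ' ∧
    ∃ β₁ β₂ : Matrix (Fin m) (Fin m) ℂ, IsBoundaryData β₁ β₂ ∧
      IsUnit (β₁ * φ c + β₂ * φ' c) ∧
      M = -((β₁ * φ c + β₂ * φ' c)⁻¹ * (β₁ * θ c + β₂ * θ' c))}

/-- The limit disk `D_+(z, a)`, for `Im z > 0`: the limit as `c → ∞`, that is the intersection
over `c > a`, of the nested sets `closure (D(z, c, a))`. -/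
def limitDisk {m : ℕ} (Q : ℝ → Matrix (Fin m) (Fin m) ℂ) (z : ℂ) (a : ℝ) :
    Set (Matrix (Fin m) (Fin m) ℂ) :=
  ⋂ c ∈ Set.Ioi a, closure (weylSet Q z c a)

/-- The open sector with vertex at zero, symmetry axis along the positive imaginary axis and
opening angle `ε`. -/
def imagSector (ε : ℝ) : Set ℂ :=
  {z | z ≠ 0 ∧ |z.arg - Real.pi / 2| < ε / 2}

-- Matrix norms are operator norms with respect to the Euclidean norm of `ℂ^m`.
open scoped Matrix.Norms.L2Operator

/-!
A matrix `N` in `D(z, c, x)` is `u'(x) u(x)⁻¹` for the solution `u = θ + φ N` that satisfies the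
boundary condition at `c`. Fix a vector `v`, let `u` stand for `(θ + φ N) v`, and put
`k = z^{1/2}`, so that `Re k` and `Im k` are both comparable to `|k|` in the sector. Two facts
carry the proof.

* The boundary form `Im ⟪u, u'⟫` decreases at the rate `Im z ‖u‖²`, because `Q` is self-adjoint, and
  it is nonnegative at `c`, because the boundary data are admissible
  (`im_inner_nonneg_of_boundary_condition`). Hence it is nonnegative on all of `[x, c]`
  (`im_inner_nonneg_of_right_endpoint`).
* Split `u` into `b = u' + i k u` and `a = u' - i k u`. They satisfy `b' = i k b + Q u` and
  `a' = -i k a + Q u`, so that `b` wants to decay and `a` to grow. The sign of the boundary form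
  excludes a purely growing solution: it forces `Re k ‖u‖ ≤ ‖b‖`
  (`re_mul_norm_le_of_im_inner_nonneg`), hence also `‖a‖ ≤ C ‖b‖`. So `Q u` is a perturbation of
  relative size `‖Q‖ / Re k`, the component `b` decays like `e^{ikt}`, and `a`, obtained from
  `a(c)` by integrating backwards, satisfies `‖a(x)‖ ≤ C |k|⁻¹ ‖b(x)‖`
  (`norm_deriv_sub_le_of_im_inner_nonneg`).

Since `a(x) = (N - i k) v` and `‖b(x)‖ ≤ ‖a(x)‖ + 2 |k| ‖v‖`, the difference `N - i k` is bounded, for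
large `|k|`, by a constant that depends only on the sector and on the integral of `‖Q‖` up to `c`.
One `c` beyond `K` serves all `x ∈ K`, and the bound passes to the closure of `D(z, c, x)`, which
contains `M_+(z, x)`.
-/

open MeasureTheory Set Filter Topology

/-! ### Absolutely continuous curves in normed spaces -/

theorem AbsolutelyContinuousOnInterval.of_dist_le {X Y Z : Type*} [PseudoMetricSpace X]
    [PseudoMetricSpace Y] [PseudoMetricSpace Z] {f : ℝ → X} {g : ℝ → Y} {h : ℝ → Z} {a b C D : ℝ}
    (hg : AbsolutelyContinuousOnInterval g a b) (hh : AbsolutelyContinuousOnInterval h a b)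
    (hf : ∀ s ∈ uIcc a b, ∀ t ∈ uIcc a b,
      dist (f s) (f t) ≤ C * dist (g s) (g t) + D * dist (h s) (h t)) :
    AbsolutelyContinuousOnInterval f a b := by
  unfold AbsolutelyContinuousOnInterval at hg hh ⊢
  have hlim := (hg.const_mul C).add (hh.const_mul D)
  simp only [mul_zero, add_zero] at hlim
  refine squeeze_zero' (Eventually.of_forall fun E => Finset.sum_nonneg fun i _ => dist_nonneg)
    ?_ hlim
  have hmem : ∀ᶠ E in totalLengthFilter ⊓ 𝓟 (disjWithin a b), E ∈ disjWithin a b :=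
    mem_inf_of_right (mem_principal_self _)
  filter_upwards [hmem] with E hE
  rw [Finset.mul_sum, Finset.mul_sum, ← Finset.sum_add_distrib]
  exact Finset.sum_le_sum fun i hi => hf _ (hE.1 i hi).1 _ (hE.1 i hi).2

theorem AbsolutelyContinuousOnInterval.le_of_ae_hasDerivAt_nonpos {f f' : ℝ → ℝ} {a b : ℝ}
    (hab : a ≤ b) (hf : AbsolutelyContinuousOnInterval f a b)
    (hd : ∀ᵐ t, t ∈ Icc a b → HasDerivAt f (f' t) t) (hf' : ∀ᵐ t, t ∈ Icc a b → f' t ≤ 0) :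
    f b ≤ f a := by
  have h := hf.integral_deriv_eq_sub
  have : ∫ t in a..b, deriv f t ≤ 0 := by
    rw [intervalIntegral.integral_of_le hab]
    refine integral_nonpos_of_ae ?_
    rw [EventuallyLE, ae_restrict_iff' measurableSet_Ioc]
    filter_upwards [hd, hf'] with t h1 h2 ht
    rw [(h1 (Ioc_subset_Icc_self ht)).deriv]
    exact h2 (Ioc_subset_Icc_self ht)
  linarith

/-- The mean value inequality for absolutely continuous curves in a normed space. No integral of
the derivative is needed: the estimate is reduced to real functions by a norming functional. -/
theorem AbsolutelyContinuousOnInterval.norm_sub_le_integral {F : Type*} [NormedAddCommGroup F]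
    [NormedSpace ℝ F] {f f' : ℝ → F} {g : ℝ → ℝ} {a b : ℝ} (hab : a ≤ b)
    (hf : AbsolutelyContinuousOnInterval f a b)
    (hd : ∀ᵐ t, t ∈ Icc a b → HasDerivAt f (f' t) t) (hg : ∀ᵐ t, t ∈ Icc a b → ‖f' t‖ ≤ g t)
    (hgi : IntervalIntegrable g volume a b) :
    ‖f b - f a‖ ≤ ∫ t in a..b, g t := by
  obtain ⟨l, hl1, hl2⟩ := exists_dual_vector'' ℝ (f b - f a)
  have hbound (y : F) : ‖l y‖ ≤ ‖y‖ := by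
    simpa using l.le_of_opNorm_le hl1 y
  have hlf : AbsolutelyContinuousOnInterval (fun t => l (f t)) a b := by
    refine hf.of_dist_le (C := 1) (D := 0) hf fun s _ t _ => ?_
    rw [dist_eq_norm, dist_eq_norm, ← map_sub, one_mul, zero_mul, add_zero]
    exact hbound _
  have h := hlf.integral_deriv_eq_sub
  rw [← map_sub, hl2] at h
  simp only [RCLike.ofReal_real_eq_id, id] at h
  rw [← h]
  refine intervalIntegral.integral_mono_ae_restrict hab hlf.intervalIntegrable_deriv hgi ?_
  rw [EventuallyLE, ae_restrict_iff' measurableSet_Icc]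
  filter_upwards [hd, hg] with t h1 h2 ht
  have h3 : HasDerivAt (fun t => l (f t)) (l (f' t)) t := l.hasFDerivAt.comp_hasDerivAt t (h1 ht)
  rw [h3.deriv]
  exact (le_abs_self _).trans ((hbound _).trans (h2 ht))

theorem AbsolutelyContinuousOnInterval.of_hasDerivWithinAt {F : Type*} [NormedAddCommGroup F]
    [NormedSpace ℝ F] {f f' : ℝ → F} {a b : ℝ} (hab : a ≤ b)
    (hd : ∀ t ∈ Icc a b, HasDerivWithinAt f (f' t) (Icc a b) t) (hf' : ContinuousOn f' (Icc a b)) :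
    AbsolutelyContinuousOnInterval f a b := by
  obtain ⟨C, hC⟩ := isCompact_Icc.exists_bound_of_continuousOn hf'
  have hL : LipschitzOnWith C.toNNReal f (Icc a b) :=
    (convex_Icc a b).lipschitzOnWith_of_nnnorm_hasDerivWithin_le hd fun t ht => by
      rw [← NNReal.coe_le_coe, coe_nnnorm]
      exact (hC t ht).trans (Real.le_coe_toNNReal C)
  rw [← uIcc_of_le hab] at hL
  exact hL.absolutelyContinuousOnInterval

theorem AbsolutelyContinuousOnInterval.sum {ι F : Type*} [Fintype ι] [SeminormedAddCommGroup F]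
    {f : ι → ℝ → F} {a b : ℝ} (hf : ∀ i, AbsolutelyContinuousOnInterval (f i) a b) :
    AbsolutelyContinuousOnInterval (fun t => ∑ i, f i t) a b := by
  suffices h : ∀ s : Finset ι, AbsolutelyContinuousOnInterval (fun t => ∑ i ∈ s, f i t) a b from
    h Finset.univ
  classical
  intro s
  induction s using Finset.induction_on with
  | empty =>
    simpa using (LipschitzWith.const (0 : F)).lipschitzOnWith.absolutelyContinuousOnInterval
  | insert i s hi ih =>
    simp only [Finset.sum_insert hi]
    exact (hf i).fun_add ih

theorem AbsolutelyContinuousOnInterval.smul_const {F : Type*} [SeminormedAddCommGroup F]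
    [NormedSpace ℂ F] {f : ℝ → ℂ} {a b : ℝ} (hf : AbsolutelyContinuousOnInterval f a b) (x : F) :
    AbsolutelyContinuousOnInterval (fun t => f t • x) a b :=
  hf.fun_smul (LipschitzWith.const x).lipschitzOnWith.absolutelyContinuousOnInterval

/-! ### Boundary forms and boundary conditions -/

section InnerProduct

variable {E : Type*} [NormedAddCommGroup E] [InnerProductSpace ℂ E]

local notation "⟪" x ", " y "⟫" => inner ℂ x y

theorem AbsolutelyContinuousOnInterval.im_inner {u v : ℝ → E} {a b : ℝ}
    (hu : AbsolutelyContinuousOnInterval u a b) (hv : AbsolutelyContinuousOnInterval v a b) :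
    AbsolutelyContinuousOnInterval (fun t => (⟪u t, v t⟫).im) a b := by
  obtain ⟨C, hC⟩ := hu.exists_bound
  obtain ⟨D, hD⟩ := hv.exists_bound
  refine hu.of_dist_le (C := D) (D := C) hv fun s hs t ht => ?_
  have h : ⟪u s, v s⟫ - ⟪u t, v t⟫ = ⟪u s - u t, v s⟫ + ⟪u t, v s - v t⟫ := by
    rw [inner_sub_left, inner_sub_right]; ring
  rw [Real.dist_eq, ← Complex.sub_im, h, dist_eq_norm, dist_eq_norm]
  refine (Complex.abs_im_le_norm _).trans ((norm_add_le _ _).trans (add_le_add ?_ ?_))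
  · refine (norm_inner_le_norm _ _).trans ?_
    rw [mul_comm]
    gcongr
    exact hD s hs
  · refine (norm_inner_le_norm _ _).trans ?_
    gcongr
    exact hC t ht

theorem re_inner_I_smul_right (x y : E) : (⟪x, Complex.I • y⟫).re = (⟪y, x⟫).im := by
  have h := congrArg Complex.im (inner_conj_symm x y)
  rw [Complex.conj_im] at h
  rw [inner_smul_right, Complex.I_mul_re, ← h, neg_neg]

/-- `‖x + i y‖² - ‖x - i y‖² = 4 Im ⟪y, x⟫`, the identity behind the Cayley transform. -/
theorem norm_add_I_smul_sq (x y : E) :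
    ‖x + Complex.I • y‖ ^ 2 = ‖x - Complex.I • y‖ ^ 2 + 4 * (⟪y, x⟫).im := by
  have h1 := norm_add_sq (𝕜 := ℂ) x (Complex.I • y)
  have h2 := norm_sub_sq (𝕜 := ℂ) x (Complex.I • y)
  have h3 : RCLike.re ⟪x, Complex.I • y⟫ = (⟪y, x⟫).im := re_inner_I_smul_right x y
  rw [h3] at h1 h2
  linarith

/-- If `ker B₁^* ∩ ker B₂^* = 0` and `Im (B₂ B₁^*) ≥ 0`, then the boundary condition
`B₁ u + B₂ u' = 0` makes the boundary form `Im ⟪u, u'⟫` nonnegative. With `W± = B₁ ± i B₂` the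
condition reads `W₋ (u' - i u) = W₊ (u' + i u)`; as `W₋ W₋^* ≥ W₊ W₊^*` and `W₋^*` is bijective,
`‖u' - i u‖ ≤ ‖u' + i u‖`. -/
theorem im_inner_nonneg_of_boundary_condition [FiniteDimensional ℂ E] {B₁ B₂ : E →L[ℂ] E}
    (hker : ∀ v, ContinuousLinearMap.adjoint B₁ v = 0 → ContinuousLinearMap.adjoint B₂ v = 0 →
      v = 0)
    (him : ∀ v, 0 ≤ (⟪ContinuousLinearMap.adjoint B₂ v, ContinuousLinearMap.adjoint B₁ v⟫).im)
    {u u' : E} (hu : B₁ u + B₂ u' = 0) : 0 ≤ (⟪u, u'⟫).im := by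
  set P := ContinuousLinearMap.adjoint B₁ with hP
  set R := ContinuousLinearMap.adjoint B₂ with hR
  have hinj : Function.Injective ((P + Complex.I • R : E →L[ℂ] E) : E →ₗ[ℂ] E) := by
    rw [injective_iff_map_eq_zero]
    intro v hv
    have hv' : P v + Complex.I • R v = 0 := by simpa using hv
    have h1 := norm_add_sq (𝕜 := ℂ) (P v) (Complex.I • R v)
    have h3 : RCLike.re ⟪P v, Complex.I • R v⟫ = (⟪R v, P v⟫).im := re_inner_I_smul_right _ _
    rw [hv', h3, norm_smul, Complex.norm_I, one_mul, norm_zero] at h1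
    have h4 := him v
    refine hker v (norm_eq_zero.1 ?_) (norm_eq_zero.1 ?_) <;>
      nlinarith [sq_nonneg ‖P v‖, sq_nonneg ‖R v‖]
  -- Solve `W₋^* v = u' - i u`, where `W₋^* = B₁^* + i B₂^*`.
  obtain ⟨v, hv⟩ := (LinearMap.injective_iff_surjective.1 hinj) (u' - Complex.I • u)
  have hv : P v + Complex.I • R v = u' - Complex.I • u := by simpa using hv
  have hB : B₁ (u' - Complex.I • u) - Complex.I • B₂ (u' - Complex.I • u)
      = B₁ (u' + Complex.I • u) + Complex.I • B₂ (u' + Complex.I • u) := by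
    have h2 : B₂ u' = - B₁ u := eq_neg_of_add_eq_zero_right hu
    simp only [map_sub, map_add, map_smul, smul_sub, smul_add, smul_smul, Complex.I_mul_I, h2]
    module
  have hnorm : ‖P v - Complex.I • R v‖ ≤ ‖u' - Complex.I • u‖ := by
    have h1 := norm_add_I_smul_sq (P v) (R v)
    rw [hv] at h1
    have h4 := him v
    exact (pow_le_pow_iff_left₀ (norm_nonneg _) (norm_nonneg _) two_ne_zero).1 (by linarith)
  -- `‖u' - i u‖² = ⟪v, W₋ (u' - i u)⟫ = ⟪v, W₊ (u' + i u)⟫ = ⟪W₊^* v, u' + i u⟫`.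
  have hmain : ‖u' - Complex.I • u‖ ^ 2 ≤ ‖u' - Complex.I • u‖ * ‖u' + Complex.I • u‖ := by
    have h1 : ⟪P v + Complex.I • R v, u' - Complex.I • u⟫
        = ⟪P v - Complex.I • R v, u' + Complex.I • u⟫ := by
      have hadj (y : E) (c : ℂ) : ⟪P v + c • R v, y⟫ = ⟪v, B₁ y + (starRingEnd ℂ c) • B₂ y⟫ := by
        rw [inner_add_left, inner_smul_left, inner_add_right, inner_smul_right, hP, hR,
          ContinuousLinearMap.adjoint_inner_left, ContinuousLinearMap.adjoint_inner_left]
      have h := hadj (u' + Complex.I • u) (-Complex.I)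
      rw [neg_smul, ← sub_eq_add_neg] at h
      rw [hadj, h, map_neg, Complex.conj_I, neg_neg, neg_smul, ← sub_eq_add_neg, hB]
    have h2 : ‖u' - Complex.I • u‖ ^ 2 = ‖⟪P v - Complex.I • R v, u' + Complex.I • u⟫‖ := by
      rw [← h1, hv, inner_self_eq_norm_sq_to_K]
      simp
    rw [h2]
    exact (norm_inner_le_norm _ _).trans (by gcongr)
  have hle : ‖u' - Complex.I • u‖ ≤ ‖u' + Complex.I • u‖ := by
    rcases (norm_nonneg (u' - Complex.I • u)).eq_or_lt with h | h
    · rw [← h]; exact norm_nonneg _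
    · rw [sq] at hmain
      exact le_of_mul_le_mul_left hmain h
  have h1 := norm_add_I_smul_sq u' u
  nlinarith [norm_nonneg (u' - Complex.I • u)]

/-- Where `Im ⟪u, u'⟫ ≥ 0`, the combination `u' + i k u` controls `u`, provided `0 < Re k`. -/
theorem re_mul_norm_le_of_im_inner_nonneg {k : ℂ} {u u' : E} (h : 0 ≤ (⟪u, u'⟫).im) :
    k.re * ‖u‖ ≤ ‖u' + (Complex.I * k) • u‖ := by
  have h1 : (⟪u, u' + (Complex.I * k) • u⟫).im = (⟪u, u'⟫).im + k.re * ‖u‖ ^ 2 := by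
    rw [inner_add_right, inner_smul_right, inner_self_eq_norm_sq_to_K, Complex.add_im]
    have : ((‖u‖ : ℂ) ^ 2) = ((‖u‖ ^ 2 : ℝ) : ℂ) := by push_cast; rfl
    simp only [Complex.coe_algebraMap, this]
    rw [Complex.im_mul_ofReal]
    simp
  have h2 : k.re * ‖u‖ ^ 2 ≤ ‖u‖ * ‖u' + (Complex.I * k) • u‖ := by
    refine le_trans ?_ ((Complex.abs_im_le_norm _).trans
      (norm_inner_le_norm u (u' + (Complex.I * k) • u)))
    rw [h1]
    exact le_trans (by linarith) (le_abs_self _)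
  rcases (norm_nonneg u).eq_or_lt with h0 | h0
  · rw [← h0, mul_zero]; exact norm_nonneg _
  · refine le_of_mul_le_mul_left ?_ h0
    linarith [h2, sq ‖u‖, mul_comm k.re (‖u‖ ^ 2), mul_assoc ‖u‖ k.re ‖u‖,
      show ‖u‖ * (k.re * ‖u‖) = k.re * ‖u‖ ^ 2 by ring]

/-! ### Solutions of `u'' = (A - z) u` with nonnegative boundary form -/

theorem ae_hasDerivAt_of_hasDerivWithinAt_Icc {F : Type*} [NormedAddCommGroup F]
    [NormedSpace ℝ F] {f f' : ℝ → F} {a b : ℝ}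
    (h : ∀ t ∈ Icc a b, HasDerivWithinAt f (f' t) (Icc a b) t) :
    ∀ᵐ t, t ∈ Icc a b → HasDerivAt f (f' t) t := by
  filter_upwards [compl_mem_ae_iff.2 (measure_singleton a),
    compl_mem_ae_iff.2 (measure_singleton b)] with t h1 h2 ht
  exact (h t ht).hasDerivAt
    (Icc_mem_nhds (lt_of_le_of_ne ht.1 (Ne.symm h1)) (lt_of_le_of_ne ht.2 h2))

/-- For a solution of `u'' = (A - z) u` with symmetric `A` and `Im z ≥ 0`, the boundary form
`Im ⟪u, u'⟫` has derivative `-Im z ‖u‖² ≤ 0`, so that it is nonnegative to the left of any point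
where it is nonnegative. -/
theorem im_inner_nonneg_of_right_endpoint {u u' : ℝ → E} {A : ℝ → E →L[ℂ] E} {z : ℂ} {a c : ℝ}
    (hac : a ≤ c)
    (hu : ∀ t ∈ Icc a c, HasDerivWithinAt u (u' t) (Icc a c) t)
    (hu' : AbsolutelyContinuousOnInterval u' a c)
    (heq : ∀ᵐ t, t ∈ Icc a c → HasDerivAt u' (A t (u t) - z • u t) t)
    (hA : ∀ᵐ t, t ∈ Icc a c → ∀ v, (⟪v, A t v⟫).im = 0)
    (hz : 0 ≤ z.im) (hc : 0 ≤ (⟪u c, u' c⟫).im) {t : ℝ} (ht : t ∈ Icc a c) :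
    0 ≤ (⟪u t, u' t⟫).im := by
  have hcont := hu'.continuousOn
  rw [uIcc_of_le hac] at hcont
  have hh := (AbsolutelyContinuousOnInterval.of_hasDerivWithinAt hac hu hcont).im_inner hu'
  have hsub : Icc t c ⊆ Icc a c := Icc_subset_Icc_left ht.1
  refine hc.trans (AbsolutelyContinuousOnInterval.le_of_ae_hasDerivAt_nonpos
    (f := fun t => (⟪u t, u' t⟫).im)
    (f' := fun r => (⟪u r, A r (u r) - z • u r⟫ + ⟪u' r, u' r⟫).im) ht.2
    (hh.mono ?_) ?_ ?_)
  · rwa [uIcc_of_le ht.2, uIcc_of_le hac]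
  · filter_upwards [ae_hasDerivAt_of_hasDerivWithinAt_Icc hu, heq] with r h1 h2 hr
    exact Complex.imCLM.hasFDerivAt.comp_hasDerivAt r
      ((h1 (hsub hr)).inner ℂ (h2 (hsub hr)))
  · filter_upwards [hA] with r h1 hr
    have hself (v : E) : ⟪v, v⟫ = ((‖v‖ ^ 2 : ℝ) : ℂ) := by
      rw [inner_self_eq_norm_sq_to_K]; push_cast; rfl
    rw [inner_sub_right, inner_smul_right, hself, hself, Complex.add_im, Complex.sub_im,
      h1 (hsub hr), Complex.im_mul_ofReal, Complex.ofReal_im]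
    have := mul_nonneg hz (sq_nonneg ‖u r‖)
    linarith

/-- Factorization of `u'' = (A - z) u`: if `σ² = -z`, then `y = u' - σ u` satisfies
`y' = -σ y + A u`. Variation of constants bounds the variation of `e^{σ (t - a)} y(t)`. -/
theorem norm_exp_smul_sub_le {u u' : ℝ → E} {A : ℝ → E →L[ℂ] E} {z σ : ℂ} {a c : ℝ}
    {g : ℝ → ℝ}
    (hu : ∀ t ∈ Icc a c, HasDerivWithinAt u (u' t) (Icc a c) t)
    (hu' : AbsolutelyContinuousOnInterval u' a c)
    (heq : ∀ᵐ t, t ∈ Icc a c → HasDerivAt u' (A t (u t) - z • u t) t)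
    (hσ : σ ^ 2 = -z)
    (hg : ∀ t ∈ Icc a c, Real.exp (σ.re * (t - a)) * ‖A t (u t)‖ ≤ g t)
    (hgi : IntervalIntegrable g volume a c) {t : ℝ} (ht : t ∈ Icc a c) :
    ‖Complex.exp (σ * (t - a)) • (u' t - σ • u t) - (u' a - σ • u a)‖ ≤ ∫ r in a..t, g r := by
  have hac : a ≤ c := ht.1.trans ht.2
  have hcont := hu'.continuousOn
  rw [uIcc_of_le hac] at hcont
  have huac := AbsolutelyContinuousOnInterval.of_hasDerivWithinAt hac hu hcont
  have hexp (r : ℝ) : HasDerivAt (fun r : ℝ => Complex.exp (σ * (r - a)))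
      (Complex.exp (σ * (r - a)) * σ) r := by
    have h1 : HasDerivAt (fun w : ℂ => Complex.exp (σ * (w - a)))
        (Complex.exp (σ * (r - a)) * (σ * 1)) (r : ℂ) :=
      (((hasDerivAt_id (r : ℂ)).sub_const (a : ℂ)).const_mul σ).cexp
    simpa using h1.comp_ofReal
  have hexpac : AbsolutelyContinuousOnInterval (fun r : ℝ => Complex.exp (σ * (r - a))) a c :=
    AbsolutelyContinuousOnInterval.of_hasDerivWithinAt hac
      (fun r _ => (hexp r).hasDerivWithinAt) (by fun_prop)
  have hw := hexpac.fun_smul (hu'.fun_sub (huac.const_smul σ))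
  have hsub : Icc a t ⊆ Icc a c := Icc_subset_Icc_right ht.2
  have hsub' : uIcc a t ⊆ uIcc a c := by rwa [uIcc_of_le ht.1, uIcc_of_le hac]
  have key := AbsolutelyContinuousOnInterval.norm_sub_le_integral
    (f' := fun r => Complex.exp (σ * (r - a)) • A r (u r)) (g := g) ht.1 (hw.mono hsub') ?_ ?_
    (hgi.mono_set hsub')
  · simpa using key
  · filter_upwards [ae_hasDerivAt_of_hasDerivWithinAt_Icc hu, heq] with r h1 h2 hr
    have h3 := (hexp r).smul ((h2 (hsub hr)).sub ((h1 (hsub hr)).const_smul σ))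
    refine h3.congr_deriv ?_
    have hz : z = -σ ^ 2 := by rw [hσ, neg_neg]
    simp only [hz, Pi.sub_apply, Pi.smul_apply]
    module
  · refine Eventually.of_forall fun r hr => ?_
    rw [norm_smul, Complex.norm_exp]
    have : (σ * ((r : ℂ) - a)).re = σ.re * (r - a) := by
      rw [← Complex.ofReal_sub, Complex.re_mul_ofReal]
    rw [this]
    exact hg r (hsub hr)

/-- A solution of `u'' = (A - k²) u` on `[a, c]` with `Im ⟪u, u'⟫ ≥ 0` throughout is close to the
decaying exponential `e^{ikt}`: `‖u'(a) - i k u(a)‖ ≤ C ‖u(a)‖` with `C` independent of `k` in a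
sector, once `|k|` is large. -/
theorem norm_deriv_sub_le_of_im_inner_nonneg {u u' : ℝ → E} {A : ℝ → E →L[ℂ] E} {q : ℝ → ℝ}
    {k : ℂ} {a c s I : ℝ} (hac : a + 1 ≤ c) (hs : 0 < s)
    (hre : s * ‖k‖ ≤ k.re) (him : s * ‖k‖ ≤ k.im)
    (hu : ∀ t ∈ Icc a c, HasDerivWithinAt u (u' t) (Icc a c) t)
    (hu' : AbsolutelyContinuousOnInterval u' a c)
    (heq : ∀ᵐ t, t ∈ Icc a c → HasDerivAt u' (A t (u t) - (k ^ 2) • u t) t)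
    (hpos : ∀ t ∈ Icc a c, 0 ≤ (⟪u t, u' t⟫).im)
    (hq : ∀ t, ‖A t‖ ≤ q t) (hqi : IntervalIntegrable q volume a c)
    (hI : ∫ t in a..c, q t ≤ I) (hk0 : 0 < ‖k‖)
    (hk : 2 * ((1 + 2 / s) / s + 2 * I / s) ≤ ‖k‖) :
    ‖u' a - (Complex.I * k) • u a‖ ≤ 4 * ((1 + 2 / s) / s + 2 * I / s) * ‖u a‖ := by
  have hac' : a ≤ c := by linarith
  have haI : a ∈ Icc a c := left_mem_Icc.2 hac'
  have hcI : c ∈ Icc a c := right_mem_Icc.2 hac'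
  have hrepos : 0 < k.re := lt_of_lt_of_le (by positivity) hre
  have himpos : 0 < k.im := lt_of_lt_of_le (by positivity) him
  have hq0 (t : ℝ) : 0 ≤ q t := (norm_nonneg _).trans (hq t)
  have hI0 : 0 ≤ I := (intervalIntegral.integral_nonneg hac' fun t _ => hq0 t).trans hI
  have hint {t : ℝ} (ht : t ∈ Icc a c) : ∫ r in a..t, q r ≤ I := by
    refine le_trans ?_ hI
    exact intervalIntegral.integral_mono_interval le_rfl ht.1 ht.2
      (Eventually.of_forall fun r => hq0 r) hqi
  have hcont' := hu'.continuousOn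
  rw [uIcc_of_le hac'] at hcont'
  have hcont : ContinuousOn u (Icc a c) := fun t ht => (hu t ht).continuousWithinAt
  -- `b = u' + i k u` is the component along the decaying exponential, and dominates `u`.
  have hub (t : ℝ) (ht : t ∈ Icc a c) : ‖u t‖ ≤ ‖u' t - (-(Complex.I * k)) • u t‖ / k.re := by
    rw [le_div_iff₀ hrepos, neg_smul, sub_neg_eq_add, mul_comm]
    exact re_mul_norm_le_of_im_inner_nonneg (hpos t ht)
  have hnexp (τ : ℂ) (t : ℝ) : ‖Complex.exp (τ * (t - a))‖ = Real.exp (τ.re * (t - a)) := by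
    rw [Complex.norm_exp, ← Complex.ofReal_sub, Complex.re_mul_ofReal]
  have hσre : (-(Complex.I * k)).re = k.im := by simp
  have hσre' : (Complex.I * k).re = -k.im := by simp
  set b : ℝ → E := fun t => u' t - (-(Complex.I * k)) • u t with hb
  set β : ℝ → E := fun t => Complex.exp (-(Complex.I * k) * (t - a)) • b t with hβ
  have hβcont : ContinuousOn β (Icc a c) := by
    refine ContinuousOn.smul (by fun_prop) (hcont'.sub (hcont.const_smul _))
  have hβn (t : ℝ) : ‖β t‖ = Real.exp (k.im * (t - a)) * ‖b t‖ := by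
    rw [hβ, norm_smul, hnexp, hσre]
  have hβa : β a = b a := by simp [hβ]
  obtain ⟨p, hp, hpmax⟩ := isCompact_Icc.exists_isMaxOn ⟨a, haI⟩ hβcont.norm
  have hpmax' (t : ℝ) (ht : t ∈ Icc a c) : ‖β t‖ ≤ ‖β p‖ := hpmax ht
  have hsI : 2 * I ≤ k.re := by
    refine le_trans ?_ hre
    have h1 : 0 ≤ (1 + 2 / s) / s := by positivity
    have h2 : 2 * (2 * I / s) ≤ ‖k‖ := by linarith
    have h3 : s * (2 * (2 * I / s)) ≤ s * ‖k‖ := by gcongr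
    have h4 : s * (2 * (2 * I / s)) = 4 * I := by field_simp; ring
    linarith
  -- `e^{-ikt} b(t)` varies by at most half of its maximum.
  have hβp : ‖β p‖ ≤ 2 * ‖b a‖ := by
    have h1 := norm_exp_smul_sub_le (g := fun t => q t * (‖β p‖ / k.re)) hu hu' heq
      (σ := -(Complex.I * k)) (by rw [neg_sq, mul_pow, Complex.I_sq]; ring)
      (fun t ht => by
        rw [hσre]
        calc Real.exp (k.im * (t - a)) * ‖A t (u t)‖
            ≤ Real.exp (k.im * (t - a)) * (q t * (‖b t‖ / k.re)) := by
              gcongr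
              exact ((A t).le_of_opNorm_le (hq t) _).trans
                (mul_le_mul_of_nonneg_left (hub t ht) (hq0 t))
          _ = q t * (‖β t‖ / k.re) := by rw [hβn]; ring
          _ ≤ q t * (‖β p‖ / k.re) := by
              have := hpmax' t ht
              have := hq0 t
              gcongr) (hqi.mul_const _) hp
    rw [intervalIntegral.integral_mul_const] at h1
    have h2 : (∫ r in a..p, q r) * (‖β p‖ / k.re) ≤ ‖β p‖ / 2 := by
      calc (∫ r in a..p, q r) * (‖β p‖ / k.re) ≤ (k.re / 2) * (‖β p‖ / k.re) := by
            gcongr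
            linarith [hint hp]
        _ = ‖β p‖ / 2 := by field_simp
    have h3 := norm_le_norm_add_norm_sub' (β p) (b a)
    have h4 : ‖β p - b a‖ ≤ ‖β p‖ / 2 := h1.trans h2
    linarith
  have hbound (t : ℝ) (ht : t ∈ Icc a c) : ‖b t‖ ≤ Real.exp (-k.im * (t - a)) * (2 * ‖b a‖) := by
    have h1 := (hpmax' t ht).trans hβp
    rw [hβn] at h1
    calc ‖b t‖ = Real.exp (-k.im * (t - a)) * (Real.exp (k.im * (t - a)) * ‖b t‖) := by
          rw [← mul_assoc, ← Real.exp_add]; simp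
      _ ≤ _ := by gcongr
  have hexp1 (t : ℝ) (ht : t ∈ Icc a c) : Real.exp (-k.im * (t - a)) ≤ 1 := by
    rw [Real.exp_le_one_iff]
    nlinarith [ht.1]
  -- The component `u' - i k u` along the growing exponential is integrated from `c` down to `a`.
  have hα := norm_exp_smul_sub_le (g := fun t => q t * (2 * ‖b a‖ / k.re)) hu hu' heq
    (σ := Complex.I * k) (by rw [mul_pow, Complex.I_sq]; ring)
    (fun t ht => by
      rw [hσre']
      have h0 := hq0 t
      calc Real.exp (-k.im * (t - a)) * ‖A t (u t)‖
          ≤ 1 * (q t * (‖b t‖ / k.re)) := by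
            gcongr
            · exact hexp1 t ht
            · exact ((A t).le_of_opNorm_le (hq t) _).trans
                (mul_le_mul_of_nonneg_left (hub t ht) (hq0 t))
        _ ≤ q t * (2 * ‖b a‖ / k.re) := by
            rw [one_mul]
            gcongr
            exact (hbound t ht).trans (mul_le_of_le_one_left (by positivity) (hexp1 t ht)))
    (hqi.mul_const _) hcI
  rw [intervalIntegral.integral_mul_const] at hα
  set α : E := u' a - (Complex.I * k) • u a with hαdef
  have hkre : ‖k‖ / k.re ≤ 1 / s := by
    rw [div_le_div_iff₀ hrepos hs]; linarith
  have hac2 (t : ℝ) (ht : t ∈ Icc a c) :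
      ‖u' t - (Complex.I * k) • u t‖ ≤ (1 + 2 / s) * ‖b t‖ := by
    have h1 : u' t - (Complex.I * k) • u t = b t - (2 * (Complex.I * k)) • u t := by
      rw [hb]; module
    rw [h1]
    refine (norm_sub_le _ _).trans ?_
    have h2 : ‖(2 * (Complex.I * k)) • u t‖ ≤ 2 * ‖k‖ * (‖b t‖ / k.re) := by
      rw [norm_smul, norm_mul, norm_mul, Complex.norm_I, one_mul, Complex.norm_two]
      gcongr
      exact hub t ht
    have h3 : 2 * ‖k‖ * (‖b t‖ / k.re) ≤ 2 / s * ‖b t‖ := by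
      calc 2 * ‖k‖ * (‖b t‖ / k.re) = 2 * (‖k‖ / k.re) * ‖b t‖ := by ring
        _ ≤ 2 * (1 / s) * ‖b t‖ := by gcongr
        _ = 2 / s * ‖b t‖ := by ring
    linarith
  set D := (1 + 2 / s) / s + 2 * I / s with hD
  have hD0 : 0 ≤ D := by positivity
  have hαb : ‖α‖ ≤ D / ‖k‖ * ‖b a‖ := by
    have h1 : ‖Complex.exp (Complex.I * k * (c - a)) • (u' c - (Complex.I * k) • u c)‖
        ≤ (1 + 2 / s) / (s * ‖k‖) * ‖b a‖ := by
      rw [norm_smul, hnexp, hσre']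
      have he : 2 * (Real.exp (-k.im * (c - a)) * Real.exp (-k.im * (c - a)))
          ≤ 1 / (s * ‖k‖) := by
        rw [← Real.exp_add, ← sub_nonneg]
        have h5 : Real.exp (-k.im * (c - a) + -k.im * (c - a)) ≤ Real.exp (-(2 * (s * ‖k‖))) := by
          gcongr
          nlinarith [mul_le_mul_of_nonneg_left hac himpos.le]
        have h6 : 2 * (s * ‖k‖) ≤ Real.exp (2 * (s * ‖k‖)) := by
          linarith [Real.add_one_le_exp (2 * (s * ‖k‖))]
        have h7 : 0 < s * ‖k‖ := by positivity
        rw [Real.exp_neg] at h5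
        have h8 : (Real.exp (2 * (s * ‖k‖)))⁻¹ ≤ (2 * (s * ‖k‖))⁻¹ := by gcongr
        have h9 : 2 * (2 * (s * ‖k‖))⁻¹ = 1 / (s * ‖k‖) := by field_simp
        linarith
      calc Real.exp (-k.im * (c - a)) * ‖u' c - (Complex.I * k) • u c‖
          ≤ Real.exp (-k.im * (c - a)) *
            ((1 + 2 / s) * (Real.exp (-k.im * (c - a)) * (2 * ‖b a‖))) := by
            gcongr
            exact (hac2 c hcI).trans (by gcongr; exact hbound c hcI)
        _ = (1 + 2 / s) * (2 * (Real.exp (-k.im * (c - a)) * Real.exp (-k.im * (c - a))))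
            * ‖b a‖ := by ring
        _ ≤ (1 + 2 / s) * (1 / (s * ‖k‖)) * ‖b a‖ := by gcongr
        _ = _ := by ring
    have h2 : (∫ r in a..c, q r) * (2 * ‖b a‖ / k.re) ≤ 2 * I / (s * ‖k‖) * ‖b a‖ := by
      calc (∫ r in a..c, q r) * (2 * ‖b a‖ / k.re) ≤ I * (2 * ‖b a‖ / (s * ‖k‖)) := by gcongr
        _ = _ := by ring
    have h3 := norm_le_norm_add_norm_sub
      (Complex.exp (Complex.I * k * (c - a)) • (u' c - (Complex.I * k) • u c)) α
    have h4 : D / ‖k‖ * ‖b a‖ = (1 + 2 / s) / (s * ‖k‖) * ‖b a‖ + 2 * I / (s * ‖k‖) * ‖b a‖ := by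
      rw [hD]; field_simp
    linarith
  have hba : ‖b a‖ ≤ ‖α‖ + 2 * ‖k‖ * ‖u a‖ := by
    have h1 : b a = α + (2 * (Complex.I * k)) • u a := by
      rw [hb, hαdef]; module
    rw [h1]
    refine (norm_add_le _ _).trans ?_
    rw [norm_smul, norm_mul, norm_mul, Complex.norm_I, one_mul, Complex.norm_two]
  have hDk : D / ‖k‖ ≤ 1 / 2 := by
    rw [div_le_div_iff₀ hk0 two_pos]; linarith
  have h1 : ‖α‖ ≤ D / ‖k‖ * (‖α‖ + 2 * ‖k‖ * ‖u a‖) :=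
    hαb.trans (by gcongr)
  have h2 : D / ‖k‖ * ‖α‖ ≤ 1 / 2 * ‖α‖ := by gcongr
  have h3 : D / ‖k‖ * (2 * ‖k‖ * ‖u a‖) = 2 * D * ‖u a‖ := by field_simp
  rw [mul_add, h3] at h1
  linarith

end InnerProduct

/-! ### Matrix solutions and Weyl sets -/

open scoped ComplexOrder in
theorem IsBoundaryData.im_inner_nonneg {m : ℕ} {β₁ β₂ : Matrix (Fin m) (Fin m) ℂ}
    (hβ : IsBoundaryData β₁ β₂) {u u' : EuclideanSpace ℂ (Fin m)}
    (hu : Matrix.toEuclideanCLM (𝕜 := ℂ) β₁ u + Matrix.toEuclideanCLM (𝕜 := ℂ) β₂ u' = 0) :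
    0 ≤ (inner ℂ u u').im := by
  have hadj (β : Matrix (Fin m) (Fin m) ℂ) :
      ContinuousLinearMap.adjoint (Matrix.toEuclideanCLM (𝕜 := ℂ) β)
        = Matrix.toEuclideanCLM (𝕜 := ℂ) β.conjTranspose := by
    rw [← ContinuousLinearMap.star_eq_adjoint, ← map_star]; rfl
  refine im_inner_nonneg_of_boundary_condition (fun v h1 h2 => ?_) (fun v => ?_) hu
  · rw [hadj] at h1 h2
    have h1' := congrArg WithLp.ofLp h1
    have h2' := congrArg WithLp.ofLp h2
    have := hβ.ker_inter v.ofLp (by simpa using h1') (by simpa using h2')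
    ext i
    exact congrFun this i
  · set C := β₂ * β₁.conjTranspose with hC
    have h1 : inner ℂ (ContinuousLinearMap.adjoint (Matrix.toEuclideanCLM (𝕜 := ℂ) β₂) v)
        (ContinuousLinearMap.adjoint (Matrix.toEuclideanCLM (𝕜 := ℂ) β₁) v)
        = star v.ofLp ⬝ᵥ (C.mulVec v.ofLp) := by
      rw [ContinuousLinearMap.adjoint_inner_left, hadj, EuclideanSpace.inner_eq_star_dotProduct,
        Matrix.ofLp_toEuclideanCLM, Matrix.ofLp_toEuclideanCLM, Matrix.mulVec_mulVec,
        dotProduct_comm]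
    have h2 : star v.ofLp ⬝ᵥ ((matrixIm C).mulVec v.ofLp)
        = ((star v.ofLp ⬝ᵥ (C.mulVec v.ofLp)).im : ℂ) := by
      have h3 : star v.ofLp ⬝ᵥ (C.conjTranspose.mulVec v.ofLp)
          = star (star v.ofLp ⬝ᵥ (C.mulVec v.ofLp)) := by
        rw [Matrix.star_dotProduct, Matrix.star_mulVec, Matrix.dotProduct_mulVec,
          Matrix.conjTranspose_conjTranspose]
      rw [matrixIm, Matrix.smul_mulVec, Matrix.sub_mulVec, dotProduct_smul, dotProduct_sub, h3,
        Complex.star_def, Complex.sub_conj, smul_eq_mul]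
      push_cast
      field_simp
    rw [h1]
    have h4 : (0 : ℂ) ≤ star v.ofLp ⬝ᵥ ((matrixIm C).mulVec v.ofLp) := by
      rcases hβ.im_nonneg with h | h
      · exact h.posSemidef.dotProduct_mulVec_nonneg _
      · rw [h]; simp
    rw [h2] at h4
    exact_mod_cast h4

/-- A majorant of the operator norm of `Q` whose integrability is that of the entries of `Q`. -/
noncomputable def entrySumNorm {m : ℕ} (Q : Matrix (Fin m) (Fin m) ℂ) : ℝ :=
  ∑ i, ∑ j, ‖Q i j‖ * ‖Matrix.single i j (1 : ℂ)‖

theorem norm_le_entrySumNorm {m : ℕ} (Q : Matrix (Fin m) (Fin m) ℂ) : ‖Q‖ ≤ entrySumNorm Q := by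
  conv_lhs => rw [Matrix.matrix_eq_sum_single Q]
  refine (norm_sum_le _ _).trans (Finset.sum_le_sum fun i _ => (norm_sum_le _ _).trans
    (Finset.sum_le_sum fun j _ => ?_))
  rw [← norm_smul, Matrix.smul_single, smul_eq_mul, mul_one]

theorem AbsolutelyContinuousOnInterval.toEuclideanCLM_apply {m : ℕ}
    {B : ℝ → Matrix (Fin m) (Fin m) ℂ} {a b : ℝ} (w : EuclideanSpace ℂ (Fin m))
    (hB : ∀ i j, AbsolutelyContinuousOnInterval (fun t => B t i j) a b) :
    AbsolutelyContinuousOnInterval (fun t => Matrix.toEuclideanCLM (𝕜 := ℂ) (B t) w) a b := by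
  have h : (fun t => Matrix.toEuclideanCLM (𝕜 := ℂ) (B t) w) = fun t => ∑ i, ∑ j,
      B t i j • Matrix.toEuclideanCLM (𝕜 := ℂ) (Matrix.single i j (1 : ℂ)) w := by
    funext t
    conv_lhs => rw [Matrix.matrix_eq_sum_single (B t)]
    simp only [map_sum, sum_apply]
    refine Finset.sum_congr rfl fun i _ => Finset.sum_congr rfl fun j _ => ?_
    rw [← smul_apply, ← map_smul, Matrix.smul_single, smul_eq_mul, mul_one]
  rw [h]
  exact .sum fun i => .sum fun j => (hB i j).smul_const _

/-- The quantitative form of the asymptotics: every matrix of the regular problem on `[a, c]` lies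
within a distance of `i k` that does not depend on `k`, once `|k|` is large. -/
theorem norm_sub_smul_one_le_of_mem_weylSet {m : ℕ} {Q : ℝ → Matrix (Fin m) (Fin m) ℂ}
    {k : ℂ} {a c s I : ℝ} {N : Matrix (Fin m) (Fin m) ℂ} (hac : a + 1 ≤ c) (hs : 0 < s)
    (hre : s * ‖k‖ ≤ k.re) (him : s * ‖k‖ ≤ k.im)
    (hQ : ∀ᵐ t, t ∈ Icc a c → (Q t).IsHermitian)
    (hqi : IntervalIntegrable (fun t => entrySumNorm (Q t)) volume a c)
    (hI : ∫ t in a..c, entrySumNorm (Q t) ≤ I) (hk0 : 0 < ‖k‖)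
    (hk : 2 * ((1 + 2 / s) / s + 2 * I / s) ≤ ‖k‖) (hN : N ∈ weylSet Q (k ^ 2) c a) :
    ‖N - (Complex.I * k) • (1 : Matrix (Fin m) (Fin m) ℂ)‖
      ≤ 4 * ((1 + 2 / s) / s + 2 * I / s) := by
  have hac' : a < c := by linarith
  have hrepos : 0 < k.re := lt_of_lt_of_le (by positivity) hre
  have himpos : 0 < k.im := lt_of_lt_of_le (by positivity) him
  have hI0 : 0 ≤ I := by
    refine le_trans (intervalIntegral.integral_nonneg hac'.le fun t _ => ?_) hI
    exact (norm_nonneg _).trans (norm_le_entrySumNorm (Q t))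
  obtain ⟨θ, θ', φ, φ', hsys, β₁, β₂, hβ, hunit, hNeq⟩ := hN
  rw [← Matrix.l2_opNorm_toEuclideanCLM]
  refine ContinuousLinearMap.opNorm_le_bound _ (by positivity) fun v => ?_
  -- The vector solution `u = (θ + φ N) v` satisfies the boundary condition at `c`.
  set ev : Matrix (Fin m) (Fin m) ℂ →ₗ[ℝ] EuclideanSpace ℂ (Fin m) :=
    { toFun := fun B => WithLp.toLp 2 (B.mulVec v.ofLp)
      map_add' := fun B C => by rw [Matrix.add_mulVec, WithLp.toLp_add]
      map_smul' := fun r B => by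
        rw [Matrix.smul_mulVec, WithLp.toLp_smul, RingHom.id_apply] } with hev
  have hevd (B : Matrix (Fin m) (Fin m) ℂ) : ev B = WithLp.toLp 2 (B.mulVec v.ofLp) := rfl
  have hevmul (B C : Matrix (Fin m) (Fin m) ℂ) :
      ev (B * C) = Matrix.toEuclideanCLM (𝕜 := ℂ) B (ev C) := by
    rw [hevd, hevd, Matrix.toEuclideanCLM_toLp, Matrix.mulVec_mulVec]
  have hevsmul (w : ℂ) (B : Matrix (Fin m) (Fin m) ℂ) : ev (w • B) = w • ev B := by
    rw [hevd, hevd, Matrix.smul_mulVec, WithLp.toLp_smul]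
  let evL := LinearMap.toContinuousLinearMap ev
  have hderiv {f : ℝ → Matrix (Fin m) (Fin m) ℂ} {f' : Matrix (Fin m) (Fin m) ℂ} {t : ℝ}
      {S : Set ℝ} (h : HasDerivWithinAt f f' S t) :
      HasDerivWithinAt (fun t => ev (f t)) (ev f') S t :=
    evL.hasFDerivAt.comp_hasDerivWithinAt t h
  have hderiv' {f : ℝ → Matrix (Fin m) (Fin m) ℂ} {f' : Matrix (Fin m) (Fin m) ℂ} {t : ℝ}
      (h : HasDerivAt f f' t) : HasDerivAt (fun t => ev (f t)) (ev f') t :=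
    evL.hasFDerivAt.comp_hasDerivAt t h
  have hmulN {f : ℝ → Matrix (Fin m) (Fin m) ℂ} {f' : Matrix (Fin m) (Fin m) ℂ} {t : ℝ}
      {S : Set ℝ} (h : HasDerivWithinAt f f' S t) :
      HasDerivWithinAt (fun t => f t * N) (f' * N) S t :=
    (LinearMap.toContinuousLinearMap (LinearMap.mulRight ℝ N)).hasFDerivAt.comp_hasDerivWithinAt t h
  have hmulN' {f : ℝ → Matrix (Fin m) (Fin m) ℂ} {f' : Matrix (Fin m) (Fin m) ℂ} {t : ℝ}
      (h : HasDerivAt f f' t) : HasDerivAt (fun t => f t * N) (f' * N) t :=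
    (LinearMap.toContinuousLinearMap (LinearMap.mulRight ℝ N)).hasFDerivAt.comp_hasDerivAt t h
  set u : ℝ → EuclideanSpace ℂ (Fin m) := fun t => ev (θ t + φ t * N) with hu
  set u' : ℝ → EuclideanSpace ℂ (Fin m) := fun t => ev (θ' t + φ' t * N) with hu'
  have hud : ∀ t ∈ Icc a c, HasDerivWithinAt u (u' t) (Icc a c) t := fun t ht =>
    hderiv ((((hsys.theta_sol.hasDeriv t ht.1).add (hmulN (hsys.phi_sol.hasDeriv t ht.1))).mono
      Icc_subset_Ici_self))
  have hu'ac : AbsolutelyContinuousOnInterval u' a c := by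
    have h1 := AbsolutelyContinuousOnInterval.toEuclideanCLM_apply v
      (hsys.theta_sol.absCont c hac')
    have h2 := AbsolutelyContinuousOnInterval.toEuclideanCLM_apply (ev N)
      (hsys.phi_sol.absCont c hac')
    have h3 : u' = fun t => Matrix.toEuclideanCLM (𝕜 := ℂ) (θ' t) v
        + Matrix.toEuclideanCLM (𝕜 := ℂ) (φ' t) (ev N) := by
      funext t
      rw [hu', ← hevmul]
      exact map_add ev _ _
    rw [h3]
    exact h1.fun_add h2
  have hueq : ∀ᵐ t, t ∈ Icc a c →
      HasDerivAt u' (Matrix.toEuclideanCLM (𝕜 := ℂ) (Q t) (u t) - (k ^ 2) • u t) t := by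
    have h1 := (ae_restrict_iff' measurableSet_Ici).1 hsys.theta_sol.equation
    have h2 := (ae_restrict_iff' measurableSet_Ici).1 hsys.phi_sol.equation
    filter_upwards [h1, h2] with t h1 h2 ht
    refine (hderiv' ((h1 ht.1).add (hmulN' (h2 ht.1)))).congr_deriv ?_
    rw [hu, ← hevmul, ← hevsmul, ← map_sub]
    congr 1
    rw [sub_mul, mul_add, smul_add, smul_mul_assoc, mul_assoc]
    abel
  have hsym : ∀ᵐ t, t ∈ Icc a c → ∀ w : EuclideanSpace ℂ (Fin m),
      (inner ℂ w (Matrix.toEuclideanCLM (𝕜 := ℂ) (Q t) w)).im = 0 := by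
    filter_upwards [hQ] with t h1 ht w
    rw [← Complex.conj_eq_iff_im, inner_conj_symm,
      ← ContinuousLinearMap.adjoint_inner_right, ← ContinuousLinearMap.star_eq_adjoint, ← map_star,
      Matrix.star_eq_conjTranspose, (h1 ht).eq]
  have hbc : 0 ≤ (inner ℂ (u c) (u' c)).im := by
    refine hβ.im_inner_nonneg ?_
    rw [hu, hu', ← hevmul, ← hevmul, ← map_add]
    have h1 : β₁ * (θ c + φ c * N) + β₂ * (θ' c + φ' c * N)
        = (β₁ * θ c + β₂ * θ' c) + (β₁ * φ c + β₂ * φ' c) * N := by noncomm_ring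
    have h2 : (β₁ * φ c + β₂ * φ' c) * N = -(β₁ * θ c + β₂ * θ' c) := by
      rw [hNeq, mul_neg, Matrix.mul_nonsing_inv_cancel_left _ _
        ((Matrix.isUnit_iff_isUnit_det _).1 hunit)]
    rw [h1, h2, add_neg_cancel, map_zero]
  have hz : 0 ≤ (k ^ 2).im := by
    have : (k ^ 2).im = 2 * (k.re * k.im) := by rw [sq, Complex.mul_im]; ring
    rw [this]; positivity
  have key := norm_deriv_sub_le_of_im_inner_nonneg
    (A := fun t => Matrix.toEuclideanCLM (𝕜 := ℂ) (Q t))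
    hac hs hre him hud hu'ac hueq
    (fun t ht => im_inner_nonneg_of_right_endpoint hac'.le hud hu'ac hueq hsym hz hbc ht)
    (fun t => (norm_le_entrySumNorm (Q t))) hqi hI hk0 hk
  have hua : u a = v := by
    rw [hu]
    simp only [hsys.theta_init, hsys.phi_init, zero_mul, add_zero, hevd, Matrix.one_mulVec]
  have hu'a : u' a = Matrix.toEuclideanCLM (𝕜 := ℂ) N v := by
    rw [hu']
    simp only [hsys.theta'_init, hsys.phi'_init, one_mul, zero_add]
    rfl
  rw [hua, hu'a] at key
  rw [map_sub, map_smul, map_one]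
  exact key

/-! ### The square root in the sector -/

theorem cpow_half_sq (z : ℂ) : (z ^ (1 / 2 : ℂ)) ^ 2 = z := by
  simp

theorem norm_cpow_half (z : ℂ) : ‖z ^ (1 / 2 : ℂ)‖ = ‖z‖ ^ (1 / 2 : ℝ) := by
  rw [← Real.sqrt_eq_rpow, eq_comm, Real.sqrt_eq_iff_mul_self_eq (norm_nonneg _) (norm_nonneg _),
    ← sq, ← norm_pow, cpow_half_sq]

/-- On the sector, `arg z^{1/2}` stays within `ε / 4` of `π / 4`, so both the real and the imaginary
part of `z^{1/2}` are comparable to its modulus. -/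
theorem sin_mul_norm_le_of_mem_imagSector {ε : ℝ} (hε : 0 < ε) (hεπ : ε < Real.pi) {z : ℂ}
    (hz : z ∈ imagSector ε) :
    Real.sin (Real.pi / 4 - ε / 4) * ‖z ^ (1 / 2 : ℂ)‖ ≤ (z ^ (1 / 2 : ℂ)).re ∧
    Real.sin (Real.pi / 4 - ε / 4) * ‖z ^ (1 / 2 : ℂ)‖ ≤ (z ^ (1 / 2 : ℂ)).im := by
  obtain ⟨hz0, harg⟩ := hz
  rw [abs_lt] at harg
  have him : (Complex.log z * (1 / 2)).im = z.arg / 2 := by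
    simp [Complex.mul_im, Complex.log_im]; ring
  rw [Complex.cpow_def_of_ne_zero hz0, Complex.norm_exp, Complex.exp_re, Complex.exp_im, him,
    mul_comm]
  constructor
  · rw [← Real.sin_pi_div_two_sub]
    gcongr
    exact Real.sin_le_sin_of_le_of_le_pi_div_two (by linarith) (by linarith) (by linarith)
  · gcongr
    exact Real.sin_le_sin_of_le_of_le_pi_div_two (by linarith) (by linarith) (by linarith)

/-! ### The asymptotics in the sector -/

theorem theorem3p9 {m : ℕ} (x₀ : ℝ) (Q : ℝ → Matrix (Fin m) (Fin m) ℂ)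
    (hQ_int : ∀ c, x₀ < c → ∀ i j,
      MeasureTheory.IntegrableOn (fun t => Q t i j) (Set.Icc x₀ c))
    (hQ_sa : ∀ᵐ t ∂(MeasureTheory.volume.restrict (Set.Ici x₀)), (Q t).IsHermitian)
    (ε : ℝ) (hε : 0 < ε) (hεπ : ε < Real.pi)
    (M : ℂ → ℝ → Matrix (Fin m) (Fin m) ℂ)
    (hM : ∀ z : ℂ, 0 < z.im → ∀ x : ℝ, x₀ ≤ x → M z x ∈ limitDisk Q z x)
    (K : Set ℝ) (hK : IsCompact K) (hK_sub : K ⊆ Set.Ici x₀) :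
    ∀ η : ℝ, 0 < η → ∃ R : ℝ, 0 < R ∧
      ∀ z ∈ imagSector ε, R ≤ ‖z‖ → ∀ x ∈ K,
        ‖M z x - (Complex.I * z ^ (1 / 2 : ℂ)) • (1 : Matrix (Fin m) (Fin m) ℂ)‖
          ≤ η * ‖z‖ ^ (1 / 2 : ℝ) := by
  intro η hη
  obtain ⟨B, hB⟩ := hK.bddAbove
  -- One right endpoint `c` at distance at least `1` from `K` serves all `x ∈ K`.
  set c := max B x₀ + 1 with hc
  have hx₀c : x₀ < c := by linarith [le_max_right B x₀]
  have hqint : IntegrableOn (fun t => entrySumNorm (Q t)) (Icc x₀ c) := by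
    unfold entrySumNorm
    exact integrable_finsetSum _ fun i _ => integrable_finsetSum _ fun j _ =>
      (hQ_int c hx₀c i j).norm.mul_const _
  have hq0 (t : ℝ) : 0 ≤ entrySumNorm (Q t) := (norm_nonneg _).trans (norm_le_entrySumNorm _)
  have hqint' : IntervalIntegrable (fun t => entrySumNorm (Q t)) volume x₀ c :=
    (intervalIntegrable_iff_integrableOn_Icc_of_le hx₀c.le).2 hqint
  set I := ∫ t in x₀..c, entrySumNorm (Q t) with hI
  have hI0 : 0 ≤ I := intervalIntegral.integral_nonneg hx₀c.le fun t _ => hq0 t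
  set s := Real.sin (Real.pi / 4 - ε / 4) with hsdef
  have hs : 0 < s := Real.sin_pos_of_pos_of_lt_pi (by linarith) (by linarith)
  set D := (1 + 2 / s) / s + 2 * I / s with hD
  have hD0 : 0 ≤ D := by positivity
  -- This `R` gives `0 < |k|`, the largeness `2 D ≤ |k|` of the pointwise estimate, and `4 D ≤ η |k|`.
  refine ⟨(1 + 2 * D + 4 * D / η) ^ 2, by positivity, fun z hz hzR x hx => ?_⟩
  have hxx₀ : x₀ ≤ x := hK_sub hx
  have hxc : x + 1 ≤ c := by
    have := hB hx
    linarith [le_max_left B x₀]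
  obtain ⟨hre, him⟩ := sin_mul_norm_le_of_mem_imagSector hε hεπ hz
  have hk2 := cpow_half_sq z
  rw [← norm_cpow_half]
  have hkR : 1 + 2 * D + 4 * D / η ≤ ‖z ^ (1 / 2 : ℂ)‖ := by
    rw [← hk2, norm_pow] at hzR
    exact (pow_le_pow_iff_left₀ (by positivity) (norm_nonneg _) two_ne_zero).1 hzR
  set k := z ^ (1 / 2 : ℂ) with hk
  have hDη : 0 ≤ 4 * D / η := by positivity
  have hk0 : 0 < ‖k‖ := by linarith
  have hzim : 0 < z.im := by
    have h1 : z.im = 2 * (k.re * k.im) := by rw [← hk2, sq, Complex.mul_im]; ring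
    have h2 : 0 < k.re := lt_of_lt_of_le (by positivity) hre
    have h3 : 0 < k.im := lt_of_lt_of_le (by positivity) him
    rw [h1]; positivity
  have hsub : uIcc x c ⊆ uIcc x₀ c := by
    rw [uIcc_of_le (by linarith), uIcc_of_le hx₀c.le]
    exact Icc_subset_Icc_left hxx₀
  have hmem : M z x ∈ closure (weylSet Q (k ^ 2) c x) := by
    rw [hk2]
    exact mem_iInter₂.1 (hM z hzim x hxx₀) c (by rw [mem_Ioi]; linarith)
  have hle : ‖M z x - (Complex.I * k) • (1 : Matrix (Fin m) (Fin m) ℂ)‖ ≤ 4 * D := by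
    have hclosed : IsClosed {N : Matrix (Fin m) (Fin m) ℂ |
        ‖N - (Complex.I * k) • (1 : Matrix (Fin m) (Fin m) ℂ)‖ ≤ 4 * D} :=
      isClosed_le (by fun_prop) continuous_const
    refine closure_minimal (fun N hN => ?_) hclosed hmem
    refine norm_sub_smul_one_le_of_mem_weylSet hxc hs hre him ?_ (hqint'.mono_set hsub) ?_ hk0
      (by linarith) hN
    · filter_upwards [(ae_restrict_iff' measurableSet_Ici).1 hQ_sa] with t h1 ht
      exact h1 (hxx₀.trans ht.1)
    · exact intervalIntegral.integral_mono_interval hxx₀ (by linarith) le_rfl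
        (Eventually.of_forall hq0) hqint'
  refine hle.trans ?_
  have h1 : 4 * D / η ≤ ‖k‖ := by linarith
  rw [div_le_iff₀ hη] at h1
  linarith
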